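/- Theorem (Existence and uniqueness of the weighted Riemannian Gaussian MLE). Let $d\ge 1$, let $\langle x,y\rangle_L=\sum_{j=1}^d x_jy_j-x_{d+1}y_{d+1}$ on $\mathbb{R}^{d+1}$, and let $\mathbb{H}^d=\{x\in\mathbb{R}^{d+1}:\langle x,x\rangle_L=-1,\ x_{d+1}>0\}$ be hyperbolic space of curvature $-1$, with geodesic distance $d(x,y)=\operatorname{arcosh}(-\langle x,y\rangle_L)$, Riemannian volume measure $\mathrm{vol}$ and origin $o=(0,\dots,0,1)$. For $\mu\in\mathbb{H}^d$ and $\beta>0$ let $$p(x\mid\mu,\beta)=\frac{\exp\{-\beta d^2(x,\mu)\}}{\int_{\mathbb{H}^d}\exp\{-\beta d^2(y,\mu)\}\,d\mathrm{vol}(y)}$$ be the density, with respect to $\mathrm{vol}$, of the isotropic Riemannian Gaussian distribution, and let $A_d(\beta)=\log Z_d(\beta)$, where $Z_d(\beta)=\int_{\mathbb{H}^d}\exp\{-\beta d^2(y,o)\}\,d\mathrm{vol}(y)$. Let $x_1,\dots,x_n\in\mathbb{H}^d$, let $w_1,\dots,w_n\ge 0$ be weights that are not all zero, and put $$W=\sum_{i=1}^n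 w_i,\qquad S_w(\mu)=\sum_{i=1}^n w_i\,d^2(x_i,\mu),\qquad \ell_w(\mu,\beta)=\sum_{i=1}^n w_i\log p(x_i\mid\mu,\beta).$$ Then the following statements hold. (i) $S_w$ has a unique minimizer $\hat\mu_w$ on $\mathbb{H}^d$ (the weighted Fréchet mean), and for every $\beta>0$ the point $\hat\mu_w$ is the unique maximizer of $\mu\mapsto\ell_w(\mu,\beta)$ (the weighted location MLE). (ii) The set $\{x_i:w_i>0\}$ is not a singleton if and only if $S_w(\hat\mu_w)>0$. In that case the function $\beta\mapsto\beta S_w(\hat\mu_w)+W A_d(\beta)$ has a unique minimizer $\hat\beta_w$ on $(0,\infty)$ (the unconstrained scale MLE), and $(\hat\mu_w,\hat\beta_w)$ is the unique maximizer of $\ell_w$ over $\mathbb{H}^d\times(0,\infty)$. (iii) If $\{x_i:w_i>0\}$ is a singleton, then $S_w(\hat\mu_w)=0$ and $\beta\mapsto\ell_w(\hat\mu_w,\beta)$ is unbounded above on $(0,\infty)$; in particular, neither does the function in (ii) have a minimizer on $(0,\infty)$ nor $\ell_w$ a maximizer on $\mathbb{H}^d\times(0,\infty)$. (iv) For all $0<\underline\beta\le\overline\beta<\infty$,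 the function $\beta\mapsto\beta S_w(\hat\mu_w)+W A_d(\beta)$ has a unique minimizer $\hat\beta$ on $[\underline\beta,\overline\beta]$ (the constrained scale MLE), and $(\hat\mu_w,\hat\beta)$ is the unique maximizer of $\ell_w$ over $\mathbb{H}^d\times[\underline\beta,\overline\beta]$. -/

import Mathlib

open MeasureTheory

noncomputable section

/-- The Lorentzian bilinear form `∑_{j ≤ d} x_j y_j - x_{d+1} y_{d+1}` on `ℝ^{d+1}`. -/
def lorentz {d : ℕ} (x y : Fin (d + 1) → ℝ) : ℝ :=
  ∑ j : Fin d, x j.castSucc * y j.castSucc - x (Fin.last d) * y (Fin.last d)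

/-- Hyperbolic space `ℍ^d`: the upper sheet of the hyperboloid in `ℝ^{d+1}`. -/
abbrev Hyperboloid (d : ℕ) : Type :=
  {x : Fin (d + 1) → ℝ // lorentz x x = -1 ∧ 0 < x (Fin.last d)}

/-- The geodesic distance `d(x, y) = arcosh (-⟨x, y⟩_L)`. (The instance metric that the subtype
inherits from `ℝ^{d+1}` is never used.) -/
def hdist {d : ℕ} (x y : Hyperboloid d) : ℝ :=
  Real.arcosh (-lorentz x.1 y.1)

/-- The global chart `u ↦ (u, √(1 + ‖u‖²))` of the hyperboloid, with domain all of `ℝ^d`. -/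
def graphChart {d : ℕ} (u : EuclideanSpace ℝ (Fin d)) : Hyperboloid d :=
  ⟨Fin.snoc (α := fun _ => ℝ) u.ofLp (Real.sqrt (1 + ‖u‖ ^ 2)), by
    constructor
    · simp only [lorentz, Fin.snoc_castSucc, Fin.snoc_last]
      rw [Real.mul_self_sqrt (by positivity), EuclideanSpace.real_norm_sq_eq]
      simp only [← pow_two]
      ring
    · simp only [Fin.snoc_last]
      positivity⟩

/-- The coordinate tangent vector `∂_i` of the chart at `u`: the partial derivative in the `i`-th
variable of `u ↦ (u, √(1 + ‖u‖²))`, that is `(e_i, u_i / √(1 + ‖u‖²))`. -/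
def chartTangent {d : ℕ} (u : EuclideanSpace ℝ (Fin d)) (i : Fin d) : Fin (d + 1) → ℝ :=
  Fin.snoc (α := fun _ => ℝ) (Pi.single i (1 : ℝ)) (u i / Real.sqrt (1 + ‖u‖ ^ 2))

/-- The matrix `g_{ij}(u) = ⟨∂_i, ∂_j⟩_L` of the Riemannian metric in the chart. -/
def metricMatrix {d : ℕ} (u : EuclideanSpace ℝ (Fin d)) : Matrix (Fin d) (Fin d) ℝ :=
  Matrix.of fun i j => lorentz (chartTangent u i) (chartTangent u j)

/-- The Riemannian volume measure of `ℍ^d`: `√(det g) du` in the global chart. -/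
def hypVolume (d : ℕ) : Measure (Hyperboloid d) :=
  ((volume : Measure (EuclideanSpace ℝ (Fin d))).withDensity
    fun u => ENNReal.ofReal (Real.sqrt (metricMatrix u).det)).map graphChart

/-- The origin `o = (0, …, 0, 1)`. -/
def hypOrigin (d : ℕ) : Hyperboloid d := graphChart 0

/-- The total mass `∫ exp (-β d(y, μ)²) dvol(y)` of the unnormalised Riemannian Gaussian
centred at `μ`. -/
def gaussianMass {d : ℕ} (μ : Hyperboloid d) (β : ℝ) : ℝ :=
  ∫ y, Real.exp (-β * hdist y μ ^ 2) ∂(hypVolume d)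

/-- The density `p(x | μ, β)` of the isotropic Riemannian Gaussian distribution with respect to
the Riemannian volume measure. -/
def gaussianDensity {d : ℕ} (μ : Hyperboloid d) (β : ℝ) (x : Hyperboloid d) : ℝ :=
  (gaussianMass μ β)⁻¹ * Real.exp (-β * hdist x μ ^ 2)

/-- The log-normaliser `A_d(β) = log Z_d(β)`, where `Z_d(β)` is the mass of the unnormalised
Gaussian centred at the origin. -/
def logNormalizer (d : ℕ) (β : ℝ) : ℝ :=
  Real.log (gaussianMass (hypOrigin d) β)

/-- The weighted Fréchet functional `S_w(μ) = ∑ i, w_i d(x_i, μ)²`. -/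
def frechetFunctional {d n : ℕ} (x : Fin n → Hyperboloid d) (w : Fin n → ℝ)
    (μ : Hyperboloid d) : ℝ :=
  ∑ i, w i * hdist (x i) μ ^ 2

/-- The weighted log-likelihood `ℓ_w(μ, β) = ∑ i, w_i log p(x_i | μ, β)`. -/
def weightedLogLik {d n : ℕ} (x : Fin n → Hyperboloid d) (w : Fin n → ℝ)
    (μ : Hyperboloid d) (β : ℝ) : ℝ :=
  ∑ i, w i * Real.log (gaussianDensity μ β (x i))

/-- The scale objective `β ↦ β S_w(μ) + W A_d(β)`, with `W = ∑ i, w_i`. -/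
def scaleObjective {d n : ℕ} (x : Fin n → Hyperboloid d) (w : Fin n → ℝ)
    (μ : Hyperboloid d) (β : ℝ) : ℝ :=
  β * frechetFunctional x w μ + (∑ i, w i) * logNormalizer d β

/-- The points of positive weight all coincide: the set `{x_i : w_i > 0}` is a singleton. -/
def PositiveSampleSingleton {d n : ℕ} (x : Fin n → Hyperboloid d) (w : Fin n → ℝ) : Prop :=
  ∃ p, x '' {i | 0 < w i} = {p}

end

/-! ### The Lorentzian form -/

/-! The hyperbolic plane enters through two facts: negative curvature makes squared distances
strictly convex, and homogeneity makes the mass of a Gaussian independent of its centre. By the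
second fact (`gaussianMass_eq_hypOrigin`), `ℓ_w(μ, β) = -(β S_w(μ) + W A_d(β))`, so for each `β > 0`
the location problem is exactly the minimisation of `S_w`, and the scale problem can be solved
afterwards with `μ` frozen at the Fréchet mean.

Location: `S_w` is continuous and coercive in the global chart, hence attains its minimum. Two
minimisers would be beaten by their midpoint (`hdist_hypMidpoint_sq_lt`), which follows from the
hyperbolic median identity `cosh_hdist_hypMidpoint` and the triangle inequality.

Scale: `A_d` is strictly convex by a strict Cauchy–Schwarz inequality
(`gaussianMass_midpoint_sq_lt`), so a minimiser is unique on any convex set of scales. On a compact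
interval existence is continuity. On `(0, ∞)` with `S_w > 0`, the objective blows up at `0` because
the volume is infinite, and at `∞` because `A_d` decreases slower than any linear function. If `S_w
= 0`, only `W A_d(β)` is left, and it tends to `-∞`.

Homogeneity is proved with Lorentzian reflections: the one exchanging `μ` and the origin is an
isometry whose Jacobian in the chart cancels the change of the volume density. -/

theorem lorentz_comm {d : ℕ} (x y : Fin (d + 1) → ℝ) : lorentz x y = lorentz y x := by
  simp only [lorentz, mul_comm]

theorem lorentz_add_smul_right {d : ℕ} (x y z : Fin (d + 1) → ℝ) (t : ℝ) :
    lorentz x (y + t • z) = lorentz x y + t * lorentz x z := by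
  simp only [lorentz, Pi.add_apply, Pi.smul_apply, smul_eq_mul, mul_add, Finset.sum_add_distrib,
    mul_sub, Finset.mul_sum, mul_left_comm t]
  ring

theorem lorentz_smul_right {d : ℕ} (x y : Fin (d + 1) → ℝ) (t : ℝ) :
    lorentz x (t • y) = t * lorentz x y := by
  simpa [lorentz] using lorentz_add_smul_right x 0 y t

theorem lorentz_add_right {d : ℕ} (x y z : Fin (d + 1) → ℝ) :
    lorentz x (y + z) = lorentz x y + lorentz x z := by
  simpa using lorentz_add_smul_right x y z 1

theorem lorentz_sub_right {d : ℕ} (x y z : Fin (d + 1) → ℝ) :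
    lorentz x (y - z) = lorentz x y - lorentz x z := by
  simpa [sub_eq_add_neg] using lorentz_add_smul_right x y z (-1)

theorem lorentz_add_left {d : ℕ} (x y z : Fin (d + 1) → ℝ) :
    lorentz (x + y) z = lorentz x z + lorentz y z := by
  rw [lorentz_comm, lorentz_add_right, lorentz_comm z, lorentz_comm z]

theorem lorentz_sub_left {d : ℕ} (x y z : Fin (d + 1) → ℝ) :
    lorentz (x - y) z = lorentz x z - lorentz y z := by
  rw [lorentz_comm, lorentz_sub_right, lorentz_comm z, lorentz_comm z]

theorem lorentz_smul_left {d : ℕ} (x y : Fin (d + 1) → ℝ) (t : ℝ) :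
    lorentz (t • x) y = t * lorentz x y := by
  rw [lorentz_comm, lorentz_smul_right, lorentz_comm]

theorem Hyperboloid.sum_sq {d : ℕ} (x : Hyperboloid d) :
    ∑ j : Fin d, x.1 j.castSucc ^ 2 = x.1 (Fin.last d) ^ 2 - 1 := by
  have h := x.2.1
  simp only [lorentz, ← pow_two] at h
  linarith

/-- The Lorentzian form is positive definite on the orthogonal complement of a point of `ℍ^d`. -/
theorem Hyperboloid.lorentz_self_nonneg {d : ℕ} (x : Hyperboloid d) {z : Fin (d + 1) → ℝ}
    (h : lorentz x.1 z = 0) : 0 ≤ lorentz z z ∧ (lorentz z z = 0 → z = 0) := by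
  have hcs := Finset.sum_mul_sq_le_sq_mul_sq Finset.univ
    (fun j : Fin d => x.1 j.castSucc) (fun j => z j.castSucc)
  rw [x.sum_sq] at hcs
  have hx0 := x.2.2
  simp only [lorentz, ← pow_two] at h ⊢
  rw [sub_eq_zero.1 h] at hcs
  have hZ : 0 ≤ ∑ j : Fin d, z j.castSucc ^ 2 := Finset.sum_nonneg fun _ _ => sq_nonneg _
  set Z := ∑ j : Fin d, z j.castSucc ^ 2 with hZdef
  have key : x.1 (Fin.last d) ^ 2 * (Z - z (Fin.last d) ^ 2) ≥ Z := by nlinarith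
  have hx2 : 0 < x.1 (Fin.last d) ^ 2 := by positivity
  refine ⟨?_, fun h0 => ?_⟩
  · by_contra! hneg
    nlinarith
  · rw [h0] at key
    have hZ0 : Z = 0 := by linarith
    have hl : z (Fin.last d) = 0 := by
      have : z (Fin.last d) ^ 2 = 0 := by linarith
      exact pow_eq_zero_iff two_ne_zero |>.1 this
    funext i
    refine Fin.lastCases hl (fun j => ?_) i
    have := (Finset.sum_eq_zero_iff_of_nonneg (fun _ _ => sq_nonneg _)).1 (hZdef ▸ hZ0) j
      (Finset.mem_univ j)
    simpa using this

/-- Cauchy–Schwarz on the first `d` coordinates: their norms are strictly smaller than the last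
coordinates, which are positive. -/
theorem Hyperboloid.neg_lorentz_pos {d : ℕ} (x y : Hyperboloid d) : 0 < -lorentz x.1 y.1 := by
  have hcs := Finset.sum_mul_sq_le_sq_mul_sq Finset.univ
    (fun j : Fin d => x.1 j.castSucc) (fun j => y.1 j.castSucc)
  rw [x.sum_sq, y.sum_sq] at hcs
  have hx := x.2.2
  have hy := y.2.2
  have hx1 : 0 ≤ x.1 (Fin.last d) ^ 2 - 1 := x.sum_sq ▸ Finset.sum_nonneg fun _ _ => sq_nonneg _
  have hy1 : 0 ≤ y.1 (Fin.last d) ^ 2 - 1 := y.sum_sq ▸ Finset.sum_nonneg fun _ _ => sq_nonneg _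
  have hxy : 0 < x.1 (Fin.last d) * y.1 (Fin.last d) := mul_pos hx hy
  have := abs_lt_of_sq_lt_sq
    (lt_of_le_of_lt hcs (by nlinarith) : _ < (x.1 (Fin.last d) * y.1 (Fin.last d)) ^ 2) hxy.le
  simp only [lorentz]
  linarith [(abs_lt.1 this).2]

/-- Reversed Cauchy–Schwarz. With `A = -⟨x, y⟩`, the vector `y - A x` is orthogonal to `x` and has
square `A ^ 2 - 1`, so positive definiteness on the complement of `x` settles both the bound and its
equality case. -/
theorem Hyperboloid.one_le_neg_lorentz {d : ℕ} (x y : Hyperboloid d) :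
    1 ≤ -lorentz x.1 y.1 ∧ (-lorentz x.1 y.1 = 1 → x = y) := by
  have hpos := x.neg_lorentz_pos y
  set A := -lorentz x.1 y.1 with hA
  have hxy : lorentz x.1 y.1 = -A := by rw [hA, neg_neg]
  have hxx := x.2.1
  have h := x.lorentz_self_nonneg (z := y.1 - A • x.1) (by
    rw [lorentz_sub_right, lorentz_smul_right, hxx, hxy]; ring)
  have hs : lorentz (y.1 - A • x.1) (y.1 - A • x.1) = A ^ 2 - 1 := by
    simp only [lorentz_sub_right, lorentz_sub_left, lorentz_smul_right, lorentz_smul_left, hxx,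
      y.2.1, lorentz_comm y.1 x.1, hxy]
    ring
  rw [hs] at h
  refine ⟨by nlinarith [h.1], fun h1 => ?_⟩
  have := h.2 (by rw [h1]; ring)
  rw [h1, one_smul, sub_eq_zero] at this
  exact Subtype.ext this.symm

/-- The Gram inequality behind the triangle inequality. -/
theorem Hyperboloid.gram_inequality {d : ℕ} (x p q : Hyperboloid d) :
    (lorentz x.1 p.1 * lorentz x.1 q.1 + lorentz p.1 q.1) ^ 2 ≤
      (lorentz x.1 p.1 ^ 2 - 1) * (lorentz x.1 q.1 ^ 2 - 1) := by
  set A := lorentz x.1 p.1 with hA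
  set B := lorentz x.1 q.1 with hB
  set C := lorentz p.1 q.1 with hC
  -- The quadratic is the square of `q' + t p'`, where `p'` and `q'` are the projections of `p` and
  -- `q` to the orthogonal complement of `x`; the claim is that its discriminant is nonpositive.
  have h : ∀ t : ℝ, 0 ≤ (A ^ 2 - 1) * (t * t) + (2 * (A * B + C)) * t + (B ^ 2 - 1) := by
    intro t
    have h0 := (x.lorentz_self_nonneg (z := (q.1 + B • x.1) + t • (p.1 + A • x.1)) (by
      simp only [lorentz_add_right, lorentz_smul_right, x.2.1, ← hA, ← hB]; ring)).1
    simp only [lorentz_add_right, lorentz_add_left, lorentz_smul_right, lorentz_smul_left, x.2.1,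
      p.2.1, q.2.1, lorentz_comm q.1, lorentz_comm p.1 x.1, ← hA, ← hB, ← hC] at h0
    linarith
  have := discrim_le_zero h
  rw [discrim] at this
  linarith

/-! ### The geodesic distance -/

theorem hdist_comm {d : ℕ} (x y : Hyperboloid d) : hdist x y = hdist y x := by
  rw [hdist, hdist, lorentz_comm]

theorem hdist_nonneg {d : ℕ} (x y : Hyperboloid d) : 0 ≤ hdist x y :=
  Real.arcosh_nonneg (x.one_le_neg_lorentz y).1

theorem cosh_hdist {d : ℕ} (x y : Hyperboloid d) : Real.cosh (hdist x y) = -lorentz x.1 y.1 :=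
  Real.cosh_arcosh (x.one_le_neg_lorentz y).1

theorem hdist_eq_zero_iff {d : ℕ} (x y : Hyperboloid d) : hdist x y = 0 ↔ x = y := by
  rw [hdist, Real.arcosh_eq_zero_iff (x.one_le_neg_lorentz y).1]
  refine ⟨(x.one_le_neg_lorentz y).2, ?_⟩
  rintro rfl
  rw [x.2.1, neg_neg]

/-- After applying `cosh` and the subtraction formula, this is the Gram inequality with a square
root taken. -/
theorem abs_hdist_sub_hdist_le {d : ℕ} (x p q : Hyperboloid d) :
    |hdist x p - hdist x q| ≤ hdist p q := by
  rw [← abs_of_nonneg (hdist_nonneg p q), ← Real.cosh_le_cosh, Real.cosh_sub, cosh_hdist,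
    cosh_hdist, cosh_hdist, hdist, hdist, Real.sinh_arcosh (x.one_le_neg_lorentz p).1,
    Real.sinh_arcosh (x.one_le_neg_lorentz q).1, ← Real.sqrt_mul
      (by nlinarith [(x.one_le_neg_lorentz p).1])]
  have h := Real.le_sqrt_of_sq_le (x.gram_inequality p q)
  simp only [neg_sq]
  linarith

/-- The midpoint of the geodesic segment between two points. -/
noncomputable def hypMidpoint {d : ℕ} (p q : Hyperboloid d) : Hyperboloid d :=
  -- The factor normalises `p + q`, whose Lorentzian square is `-(2 - 2⟨p, q⟩)`.
  ⟨(Real.sqrt (2 - 2 * lorentz p.1 q.1))⁻¹ • (p.1 + q.1), by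
    have h := (p.one_le_neg_lorentz q).1
    have hs : 0 < Real.sqrt (2 - 2 * lorentz p.1 q.1) := Real.sqrt_pos.2 (by linarith)
    constructor
    · simp only [lorentz_add_right, lorentz_add_left, lorentz_smul_right, lorentz_smul_left,
        p.2.1, q.2.1, lorentz_comm q.1 p.1]
      have := Real.sq_sqrt (show 0 ≤ 2 - 2 * lorentz p.1 q.1 by linarith)
      generalize Real.sqrt (2 - 2 * lorentz p.1 q.1) = s at hs this
      field_simp
      linarith
    · have := p.2.2
      have := q.2.2
      simp only [Pi.smul_apply, Pi.add_apply, smul_eq_mul]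
      positivity⟩

/-- The hyperbolic median identity. Pairing `x` with the normalised sum `p + q` adds the two
hyperbolic cosines, the half-angle formula identifies the normalising factor as `2 cosh (d(p, q) /
2)`, and sum-to-product gives the right-hand side. -/
theorem cosh_hdist_hypMidpoint {d : ℕ} (x p q : Hyperboloid d) :
    Real.cosh (hdist x (hypMidpoint p q)) * Real.cosh (hdist p q / 2) =
      Real.cosh ((hdist x p + hdist x q) / 2) * Real.cosh ((hdist x p - hdist x q) / 2) := by
  have hc := (p.one_le_neg_lorentz q).1
  have h1 : Real.cosh (hdist p q / 2) = Real.sqrt (2 - 2 * lorentz p.1 q.1) / 2 := by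
    rw [eq_div_iff two_ne_zero, eq_comm, Real.sqrt_eq_iff_mul_self_eq (by linarith)
      (by have := Real.cosh_pos (hdist p q / 2); positivity)]
    have h2 := Real.cosh_two_mul (hdist p q / 2)
    rw [mul_div_cancel₀ _ two_ne_zero, cosh_hdist] at h2
    nlinarith [Real.cosh_sq (hdist p q / 2)]
  have hs : 0 < Real.sqrt (2 - 2 * lorentz p.1 q.1) := Real.sqrt_pos.2 (by linarith)
  have h3 : Real.cosh (hdist x p) + Real.cosh (hdist x q) =
      2 * (Real.cosh ((hdist x p + hdist x q) / 2) *
        Real.cosh ((hdist x p - hdist x q) / 2)) := by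
    have e1 : hdist x p = (hdist x p + hdist x q) / 2 + (hdist x p - hdist x q) / 2 := by ring
    have e2 : hdist x q = (hdist x p + hdist x q) / 2 - (hdist x p - hdist x q) / 2 := by ring
    have c1 := Real.cosh_add ((hdist x p + hdist x q) / 2) ((hdist x p - hdist x q) / 2)
    have c2 := Real.cosh_sub ((hdist x p + hdist x q) / 2) ((hdist x p - hdist x q) / 2)
    rw [← e1] at c1
    rw [← e2] at c2
    linarith
  rw [cosh_hdist, cosh_hdist] at h3
  rw [cosh_hdist, h1]
  simp only [hypMidpoint, lorentz_add_right, lorentz_smul_right]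
  generalize Real.sqrt (2 - 2 * lorentz p.1 q.1) = s at hs
  field_simp
  linarith

/-- Squared distances are strictly convex at midpoints. -/
theorem hdist_hypMidpoint_sq_lt {d : ℕ} (x : Hyperboloid d) {p q : Hyperboloid d} (hpq : p ≠ q) :
    hdist x (hypMidpoint p q) ^ 2 < (hdist x p ^ 2 + hdist x q ^ 2) / 2 := by
  have hm := hdist_nonneg x (hypMidpoint p q)
  have ha := hdist_nonneg x p
  have hb := hdist_nonneg x q
  have ht : 0 < hdist p q :=
    (hdist_nonneg p q).lt_of_ne fun h => hpq ((hdist_eq_zero_iff p q).1 h.symm)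
  have hcosh := cosh_hdist_hypMidpoint x p q
  have htri := abs_hdist_sub_hdist_le x p q
  have hab : Real.cosh ((hdist x p - hdist x q) / 2) ≤ Real.cosh (hdist p q / 2) := by
    rw [Real.cosh_le_cosh, abs_div, abs_div, abs_of_pos ht]
    gcongr
  have hpos := Real.cosh_pos ((hdist x p + hdist x q) / 2)
  have hle : hdist x (hypMidpoint p q) ≤ (hdist x p + hdist x q) / 2 := by
    rw [← abs_of_nonneg hm, ← abs_of_nonneg (show 0 ≤ (hdist x p + hdist x q) / 2 by linarith),
      ← Real.cosh_le_cosh]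
    have := Real.cosh_pos (hdist p q / 2)
    nlinarith
  -- Strictness has two sources: if the distances agree, `cosh (d(p, q) / 2) > 1` makes the median
  -- strictly shorter; otherwise the square is strictly convex on the reals.
  by_cases hne : hdist x p = hdist x q
  · have hlt : hdist x (hypMidpoint p q) < (hdist x p + hdist x q) / 2 := by
      rw [← abs_of_nonneg hm, ← abs_of_nonneg (show 0 ≤ (hdist x p + hdist x q) / 2 by linarith),
        ← Real.cosh_lt_cosh]
      have h1 : 1 < Real.cosh (hdist p q / 2) := Real.one_lt_cosh.2 (by positivity)
      rw [hne, sub_self, zero_div, Real.cosh_zero, mul_one] at hcosh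
      rw [hne, ← hcosh]
      have := Real.cosh_pos (hdist x (hypMidpoint p q))
      nlinarith
    nlinarith
  · have := sq_pos_of_ne_zero (sub_ne_zero.2 hne)
    nlinarith

/-! ### The global chart -/

theorem graphChart_castSucc {d : ℕ} (u : EuclideanSpace ℝ (Fin d)) (j : Fin d) :
    (graphChart u).1 j.castSucc = u j := by
  simp [graphChart]

theorem graphChart_last {d : ℕ} (u : EuclideanSpace ℝ (Fin d)) :
    (graphChart u).1 (Fin.last d) = Real.sqrt (1 + ‖u‖ ^ 2) := by
  simp [graphChart]

/-- The inverse of the global chart: the first `d` coordinates. -/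
noncomputable def graphCoord {d : ℕ} (z : Fin (d + 1) → ℝ) : EuclideanSpace ℝ (Fin d) :=
  WithLp.toLp 2 fun j => z j.castSucc

theorem graphCoord_graphChart {d : ℕ} (u : EuclideanSpace ℝ (Fin d)) :
    graphCoord (graphChart u).1 = u := by
  ext j
  simp [graphCoord, graphChart_castSucc]

theorem graphChart_graphCoord {d : ℕ} (x : Hyperboloid d) : graphChart (graphCoord x.1) = x := by
  apply Subtype.ext
  funext i
  refine Fin.lastCases ?_ (fun j => ?_) i
  · rw [graphChart_last, EuclideanSpace.real_norm_sq_eq]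
    simp only [graphCoord]
    rw [x.sum_sq, add_sub_cancel, Real.sqrt_sq x.2.2.le]
  · simp [graphCoord, graphChart_castSucc]

theorem continuous_graphChart {d : ℕ} :
    Continuous (graphChart : EuclideanSpace ℝ (Fin d) → Hyperboloid d) := by
  refine Continuous.subtype_mk (continuous_pi fun i => ?_) _
  refine Fin.lastCases ?_ (fun j => ?_) i
  · simp only [Fin.snoc_last]
    fun_prop
  · simp only [Fin.snoc_castSucc]
    fun_prop

theorem continuous_hdist {d : ℕ} (μ : Hyperboloid d) :
    Continuous fun y : Hyperboloid d => hdist y μ := by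
  refine Real.continuousOn_arcosh.comp_continuous ?_ fun y => (y.one_le_neg_lorentz μ).1
  have hc : ∀ i, Continuous fun y : Hyperboloid d => y.1 i := fun i =>
    (continuous_apply i).comp continuous_subtype_val
  unfold lorentz
  exact ((continuous_finsetSum _ fun j _ => (hc _).mul_const _).sub ((hc _).mul_const _)).neg

theorem cosh_hdist_graphChart_hypOrigin {d : ℕ} (u : EuclideanSpace ℝ (Fin d)) :
    Real.cosh (hdist (graphChart u) (hypOrigin d)) = Real.sqrt (1 + ‖u‖ ^ 2) := by
  rw [cosh_hdist]
  simp [lorentz, hypOrigin, graphChart_castSucc, graphChart_last]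

/-- The metric is the identity plus a rank-one matrix, so the matrix determinant lemma applies. -/
theorem sqrt_det_metricMatrix {d : ℕ} (u : EuclideanSpace ℝ (Fin d)) :
    Real.sqrt (metricMatrix u).det = (Real.sqrt (1 + ‖u‖ ^ 2))⁻¹ := by
  have hs : 0 < 1 + ‖u‖ ^ 2 := by positivity
  have hM : metricMatrix u = 1 + Matrix.replicateCol Unit (fun i => -u i / (1 + ‖u‖ ^ 2)) *
      Matrix.replicateRow Unit (fun i => u i) := by
    ext i j
    simp only [metricMatrix, lorentz, chartTangent, Matrix.of_apply, Fin.snoc_castSucc,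
      Fin.snoc_last, Matrix.add_apply, Matrix.mul_apply, Matrix.replicateCol_apply,
      Matrix.replicateRow_apply, Finset.univ_unique, Finset.sum_singleton, Matrix.one_apply]
    rw [div_mul_div_comm, Real.mul_self_sqrt hs.le]
    simp only [Pi.single_apply, ite_mul, one_mul, zero_mul, Finset.sum_ite_eq', Finset.mem_univ,
      if_true]
    ring
  rw [hM, Matrix.det_one_add_replicateCol_mul_replicateRow, ← Real.sqrt_inv]
  congr 1
  have h1 : (fun i => u i) ⬝ᵥ (fun i => -u i / (1 + ‖u‖ ^ 2)) = -‖u‖ ^ 2 / (1 + ‖u‖ ^ 2) := by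
    rw [EuclideanSpace.real_norm_sq_eq, dotProduct, ← Finset.sum_neg_distrib, Finset.sum_div]
    refine Finset.sum_congr rfl fun i _ => ?_
    ring
  rw [h1]
  field_simp
  ring

theorem integral_hypVolume {d : ℕ} {f : Hyperboloid d → ℝ} (hf : Continuous f) :
    ∫ y, f y ∂(hypVolume d) =
      ∫ u : EuclideanSpace ℝ (Fin d), (Real.sqrt (1 + ‖u‖ ^ 2))⁻¹ * f (graphChart u) := by
  rw [hypVolume, integral_map continuous_graphChart.measurable.aemeasurable
    hf.measurable.aestronglyMeasurable]
  simp only [sqrt_det_metricMatrix]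
  have hm : Measurable fun u : EuclideanSpace ℝ (Fin d) =>
      ((Real.sqrt (1 + ‖u‖ ^ 2))⁻¹).toNNReal := by fun_prop
  have := integral_withDensity_eq_integral_smul (μ := volume) hm fun u => f (graphChart u)
  refine this.trans (integral_congr_ae (Filter.Eventually.of_forall fun u => ?_))
  simp only [NNReal.smul_def, smul_eq_mul]
  rw [Real.coe_toNNReal _ (by positivity)]

/-! ### Lorentzian reflections and homogeneity of the volume -/

/-- The Lorentzian reflection along `n`. -/
noncomputable def lorentzReflection {d : ℕ} (n z : Fin (d + 1) → ℝ) : Fin (d + 1) → ℝ :=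
  z + (-(2 / lorentz n n * lorentz n z)) • n

theorem lorentz_lorentzReflection {d : ℕ} {n : Fin (d + 1) → ℝ} (hn : lorentz n n ≠ 0)
    (y z : Fin (d + 1) → ℝ) :
    lorentz (lorentzReflection n y) (lorentzReflection n z) = lorentz y z := by
  simp only [lorentzReflection, lorentz_add_right, lorentz_add_left, lorentz_smul_right,
    lorentz_smul_left, lorentz_comm y n]
  field_simp
  ring

theorem lorentzReflection_lorentzReflection {d : ℕ} {n : Fin (d + 1) → ℝ}
    (hn : lorentz n n ≠ 0) (z : Fin (d + 1) → ℝ) :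
    lorentzReflection n (lorentzReflection n z) = z := by
  have h : lorentz n (lorentzReflection n z) = -lorentz n z := by
    simp only [lorentzReflection, lorentz_add_right, lorentz_smul_right]
    field_simp
    ring
  rw [lorentzReflection, h, lorentzReflection, add_assoc, ← add_smul]
  simp

theorem lorentz_sub_self_pos {d : ℕ} {p q : Hyperboloid d} (hpq : p ≠ q) :
    0 < lorentz (p.1 - q.1) (p.1 - q.1) := by
  have h := p.one_le_neg_lorentz q
  have : 1 < -lorentz p.1 q.1 := h.1.lt_of_ne fun h1 => hpq (h.2 h1.symm)
  simp only [lorentz_sub_left, lorentz_sub_right, p.2.1, q.2.1, lorentz_comm q.1 p.1]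
  linarith

/-- For `n = p - q`, `2⟨n, p⟩ = ⟨n, n⟩`, so the reflection subtracts exactly `n` from `p`. -/
theorem lorentzReflection_sub {d : ℕ} {p q : Hyperboloid d} (hpq : p ≠ q) :
    lorentzReflection (p.1 - q.1) p.1 = q.1 := by
  have hn := lorentz_sub_self_pos hpq
  have h2 : 2 / lorentz (p.1 - q.1) (p.1 - q.1) * lorentz (p.1 - q.1) p.1 = 1 := by
    rw [div_mul_eq_mul_div, div_eq_one_iff_eq hn.ne']
    simp only [lorentz_sub_left, lorentz_sub_right, p.2.1, q.2.1, lorentz_comm q.1 p.1]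
    ring
  rw [lorentzReflection, h2]
  simp

/-- The isometry of `ℍ^d` given by the reflection that exchanges `p` and the origin. -/
noncomputable def hypReflection {d : ℕ} {p : Hyperboloid d} (hp : p ≠ hypOrigin d)
    (y : Hyperboloid d) : Hyperboloid d :=
  ⟨lorentzReflection (p.1 - (hypOrigin d).1) y.1, by
    have hn := (lorentz_sub_self_pos hp).ne'
    refine ⟨(lorentz_lorentzReflection hn _ _).trans y.2.1, ?_⟩
    -- The last coordinate of a vector is minus its pairing with the origin. The reflection sends
    -- `p` to the origin, so the last coordinate of the image is `-⟨y, p⟩ > 0`.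
    have h1 := lorentz_lorentzReflection hn y.1 p.1
    rw [lorentzReflection_sub hp] at h1
    have h2 := y.neg_lorentz_pos p
    rw [← h1] at h2
    simpa [lorentz, hypOrigin, graphChart_castSucc, graphChart_last] using h2⟩

theorem hypReflection_hypReflection {d : ℕ} {p : Hyperboloid d} (hp : p ≠ hypOrigin d)
    (y : Hyperboloid d) : hypReflection hp (hypReflection hp y) = y :=
  Subtype.ext (lorentzReflection_lorentzReflection (lorentz_sub_self_pos hp).ne' _)

theorem hdist_hypReflection {d : ℕ} {p : Hyperboloid d} (hp : p ≠ hypOrigin d)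
    (y : Hyperboloid d) : hdist (hypReflection hp y) (hypOrigin d) = hdist y p := by
  have h := lorentz_lorentzReflection (lorentz_sub_self_pos hp).ne' y.1 p.1
  rw [lorentzReflection_sub hp] at h
  simp only [hdist, hypReflection, h]

theorem hasFDerivAt_sqrt_one_add_norm_sq {d : ℕ} (u : EuclideanSpace ℝ (Fin d)) :
    HasFDerivAt (fun v : EuclideanSpace ℝ (Fin d) => Real.sqrt (1 + ‖v‖ ^ 2))
      ((Real.sqrt (1 + ‖u‖ ^ 2))⁻¹ • innerSL ℝ u) u := by
  have h := ((hasStrictFDerivAt_norm_sq u).hasFDerivAt.const_add 1).sqrt (by positivity)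
  refine h.congr_fderiv ?_
  rw [← Nat.cast_smul_eq_nsmul ℝ, smul_smul]
  congr 1
  push_cast
  field_simp

theorem lorentz_graphChart {d : ℕ} (n : Fin (d + 1) → ℝ) (u : EuclideanSpace ℝ (Fin d)) :
    lorentz n (graphChart u).1 =
      inner ℝ (graphCoord n) u - n (Fin.last d) * Real.sqrt (1 + ‖u‖ ^ 2) := by
  simp only [lorentz, graphChart_castSucc, graphChart_last, graphCoord, PiLp.inner_apply]
  congr 1
  refine Finset.sum_congr rfl fun i _ => ?_
  simp [mul_comm]

theorem lorentz_self_eq {d : ℕ} (n : Fin (d + 1) → ℝ) :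
    lorentz n n = ‖graphCoord n‖ ^ 2 - n (Fin.last d) ^ 2 := by
  rw [EuclideanSpace.real_norm_sq_eq]
  simp only [lorentz, graphCoord, pow_two]

/-- The derivative, in the chart, of a Lorentzian reflection. -/
noncomputable def reflectionDeriv {d : ℕ} (n : Fin (d + 1) → ℝ) (u : EuclideanSpace ℝ (Fin d)) :
    EuclideanSpace ℝ (Fin d) →L[ℝ] EuclideanSpace ℝ (Fin d) :=
  ContinuousLinearMap.id ℝ _ + (-((2 / lorentz n n) • (innerSL ℝ (graphCoord n) -
    n (Fin.last d) • ((Real.sqrt (1 + ‖u‖ ^ 2))⁻¹ • innerSL ℝ u)))).smulRight (graphCoord n)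

theorem graphCoord_lorentzReflection {d : ℕ} (n : Fin (d + 1) → ℝ)
    (u : EuclideanSpace ℝ (Fin d)) :
    graphCoord (lorentzReflection n (graphChart u).1) =
      u + (-(2 / lorentz n n * (inner ℝ (graphCoord n) u -
        n (Fin.last d) * Real.sqrt (1 + ‖u‖ ^ 2)))) • graphCoord n := by
  rw [← lorentz_graphChart]
  ext j
  simp [graphCoord, lorentzReflection, graphChart_castSucc]

theorem hasFDerivAt_reflection {d : ℕ} (n : Fin (d + 1) → ℝ) (u : EuclideanSpace ℝ (Fin d)) :
    HasFDerivAt (fun v => graphCoord (lorentzReflection n (graphChart v).1))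
      (reflectionDeriv n u) u := by
  simp only [graphCoord_lorentzReflection]
  refine (hasFDerivAt_id u).add (HasFDerivAt.smul_const ?_ _)
  exact (((innerSL ℝ (graphCoord n)).hasFDerivAt.sub
    ((hasFDerivAt_sqrt_one_add_norm_sq u).const_mul _)).const_mul _).neg

/-- The derivative is a rank-one perturbation of the identity, with determinant `1 + f v`. The
result says that the Jacobian is, up to sign, the ratio of last coordinates of image and source,
which is the inverse ratio of the volume densities. -/
theorem det_reflectionDeriv {d : ℕ} {n : Fin (d + 1) → ℝ} (hn : lorentz n n ≠ 0)
    (u : EuclideanSpace ℝ (Fin d)) :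
    (reflectionDeriv n u).det * Real.sqrt (1 + ‖u‖ ^ 2) =
      -lorentzReflection n (graphChart u).1 (Fin.last d) := by
  have hs : 0 < Real.sqrt (1 + ‖u‖ ^ 2) := by positivity
  have h : (reflectionDeriv n u).det = 1 + -(2 / lorentz n n * (‖graphCoord n‖ ^ 2 -
      n (Fin.last d) * ((Real.sqrt (1 + ‖u‖ ^ 2))⁻¹ * inner ℝ (graphCoord n) u))) := by
    set f := -((2 / lorentz n n) • (innerSL ℝ (graphCoord n) -
      n (Fin.last d) • ((Real.sqrt (1 + ‖u‖ ^ 2))⁻¹ • innerSL ℝ u))) with hf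
    have h1 : (reflectionDeriv n u).det =
        (LinearMap.transvection f.toLinearMap (graphCoord n)).det := by
      rw [ContinuousLinearMap.det]
      congr 1
    rw [h1, LinearMap.transvection.det, hf]
    simp [real_inner_comm (graphCoord n) u]
  have hN := lorentz_self_eq n
  rw [h]
  simp only [lorentzReflection, Pi.add_apply, Pi.smul_apply, smul_eq_mul, graphChart_last,
    lorentz_graphChart]
  have hg : ‖graphCoord n‖ ^ 2 = lorentz n n + n (Fin.last d) ^ 2 := by linarith
  rw [hg]
  field_simp
  ring

theorem gaussianMass_eq {d : ℕ} (μ : Hyperboloid d) (β : ℝ) :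
    gaussianMass μ β = ∫ u : EuclideanSpace ℝ (Fin d), (Real.sqrt (1 + ‖u‖ ^ 2))⁻¹ *
      Real.exp (-β * hdist (graphChart u) μ ^ 2) := by
  refine integral_hypVolume (f := fun y => Real.exp (-β * hdist y μ ^ 2)) ?_
  have := continuous_hdist μ
  fun_prop

/-- The mass of the unnormalised Gaussian does not depend on its centre. -/
theorem gaussianMass_eq_hypOrigin {d : ℕ} (μ : Hyperboloid d) (β : ℝ) :
    gaussianMass μ β = gaussianMass (hypOrigin d) β := by
  by_cases hμ : μ = hypOrigin d
  · rw [hμ]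
  set n := μ.1 - (hypOrigin d).1 with hn
  have hn0 : lorentz n n ≠ 0 := (lorentz_sub_self_pos hμ).ne'
  set φ : EuclideanSpace ℝ (Fin d) → EuclideanSpace ℝ (Fin d) :=
    fun v => graphCoord (lorentzReflection n (graphChart v).1) with hφ
  have hchart : ∀ u, graphChart (φ u) = hypReflection hμ (graphChart u) := fun u =>
    graphChart_graphCoord (hypReflection hμ (graphChart u))
  have hinv : Function.Involutive φ := fun u => by
    have : φ (φ u) = graphCoord (hypReflection hμ (graphChart (φ u))).1 := rfl
    rw [this, hchart, hypReflection_hypReflection, graphCoord_graphChart]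
  -- Change of variables along `φ`, the reflection read in the chart; being an involution, it is a
  -- bijection of the whole chart domain.
  have hcv := integral_image_eq_integral_abs_det_fderiv_smul volume MeasurableSet.univ
    (fun u _ => (hasFDerivAt_reflection n u).hasFDerivWithinAt) hinv.injective.injOn
    (fun u => (Real.sqrt (1 + ‖u‖ ^ 2))⁻¹ *
      Real.exp (-β * hdist (graphChart u) (hypOrigin d) ^ 2))
  rw [Set.image_univ, hinv.surjective.range_eq, setIntegral_univ, setIntegral_univ] at hcv
  rw [gaussianMass_eq, gaussianMass_eq, hcv]
  refine integral_congr_ae (Filter.Eventually.of_forall fun u => ?_)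
  have hs : 0 < Real.sqrt (1 + ‖u‖ ^ 2) := by positivity
  have hs' : 0 < Real.sqrt (1 + ‖φ u‖ ^ 2) := by positivity
  have hdet := det_reflectionDeriv hn0 u
  have hlast : lorentzReflection n (graphChart u).1 (Fin.last d) = Real.sqrt (1 + ‖φ u‖ ^ 2) := by
    rw [← graphChart_last, hchart]
    rfl
  rw [hlast] at hdet
  have habs : |(reflectionDeriv n u).det| =
      Real.sqrt (1 + ‖φ u‖ ^ 2) / Real.sqrt (1 + ‖u‖ ^ 2) := by
    rw [eq_div_of_mul_eq hs.ne' hdet, abs_div, abs_neg, abs_of_pos hs, abs_of_pos hs']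
  change _ = |(reflectionDeriv n u).det| • ((Real.sqrt (1 + ‖φ u‖ ^ 2))⁻¹ *
      Real.exp (-β * hdist (graphChart (φ u)) (hypOrigin d) ^ 2))
  rw [habs, hchart, hdist_hypReflection, smul_eq_mul]
  field_simp

/-! ### The normalising constant -/

/-- The Gaussian integrand centred at the origin, written in the global chart. -/
noncomputable def chartGaussian {d : ℕ} (β : ℝ) (u : EuclideanSpace ℝ (Fin d)) : ℝ :=
  (Real.sqrt (1 + ‖u‖ ^ 2))⁻¹ * Real.exp (-β * hdist (graphChart u) (hypOrigin d) ^ 2)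

theorem gaussianMass_hypOrigin (d : ℕ) (β : ℝ) :
    gaussianMass (hypOrigin d) β = ∫ u : EuclideanSpace ℝ (Fin d), chartGaussian β u :=
  gaussianMass_eq _ _

theorem continuous_hdist_graphChart (d : ℕ) : Continuous fun u : EuclideanSpace ℝ (Fin d) =>
    hdist (graphChart u) (hypOrigin d) :=
  (continuous_hdist _).comp continuous_graphChart

theorem continuous_inv_sqrt_one_add_norm_sq (d : ℕ) :
    Continuous fun u : EuclideanSpace ℝ (Fin d) => (Real.sqrt (1 + ‖u‖ ^ 2))⁻¹ :=
  Continuous.inv₀ (by fun_prop) fun u => by positivity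

theorem continuous_chartGaussian {d : ℕ} (β : ℝ) :
    Continuous (chartGaussian β : EuclideanSpace ℝ (Fin d) → ℝ) := by
  have h1 := continuous_hdist_graphChart d
  have h2 := continuous_inv_sqrt_one_add_norm_sq d
  unfold chartGaussian
  fun_prop

theorem chartGaussian_pos {d : ℕ} (β : ℝ) (u : EuclideanSpace ℝ (Fin d)) :
    0 < chartGaussian β u := by
  unfold chartGaussian
  positivity

theorem chartGaussian_anti {d : ℕ} {a b : ℝ} (hab : a ≤ b) (u : EuclideanSpace ℝ (Fin d)) :
    chartGaussian b u ≤ chartGaussian a u := by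
  unfold chartGaussian
  gcongr

/-- The square root is `cosh r`, with `r` the distance to the origin, and `cosh r ≤ exp r` for `r ≥
0`. -/
theorem log_sqrt_le_hdist {d : ℕ} (u : EuclideanSpace ℝ (Fin d)) :
    Real.log (Real.sqrt (1 + ‖u‖ ^ 2)) ≤ hdist (graphChart u) (hypOrigin d) := by
  rw [Real.log_le_iff_le_exp (by positivity), ← cosh_hdist_graphChart_hypOrigin, Real.cosh_eq]
  have := Real.exp_le_exp.2 (show -hdist (graphChart u) (hypOrigin d) ≤
    hdist (graphChart u) (hypOrigin d) by linarith [hdist_nonneg (graphChart u) (hypOrigin d)])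
  linarith

/-- Completing the square gives `-β r² ≤ N² / (4β) - N r`, and `r ≥ log (1 + ‖u‖²) / 2`. The
integrand is thus dominated by a multiple of `(1 + ‖u‖²) ^ (-N / 2)`, integrable because `N = d + 1`
exceeds the dimension. -/
theorem integrable_chartGaussian {d : ℕ} {β : ℝ} (hβ : 0 < β) :
    Integrable (chartGaussian β : EuclideanSpace ℝ (Fin d) → ℝ) := by
  set N : ℝ := d + 1 with hN
  have hN0 : 0 < N := by positivity
  have hint : Integrable (fun u : EuclideanSpace ℝ (Fin d) => Real.exp (N ^ 2 / (4 * β)) *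
      (1 + ‖u‖ ^ 2) ^ (-N / 2)) :=
    (integrable_rpow_neg_one_add_norm_sq (by simp [hN])).const_mul _
  refine hint.mono' (continuous_chartGaussian β).aestronglyMeasurable
    (Filter.Eventually.of_forall fun u => ?_)
  rw [Real.norm_of_nonneg (chartGaussian_pos β u).le]
  have hs : (0 : ℝ) < 1 + ‖u‖ ^ 2 := by positivity
  have h1 : Real.log (1 + ‖u‖ ^ 2) / 2 ≤ hdist (graphChart u) (hypOrigin d) := by
    rw [← Real.log_sqrt hs.le]
    exact log_sqrt_le_hdist u
  have h2 : (Real.sqrt (1 + ‖u‖ ^ 2))⁻¹ ≤ 1 :=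
    inv_le_one_of_one_le₀ (Real.one_le_sqrt.2 (by nlinarith [sq_nonneg ‖u‖]))
  set r := hdist (graphChart u) (hypOrigin d) with hr
  have h3 : -β * r ^ 2 ≤ N ^ 2 / (4 * β) - N * r := by
    have : N ^ 2 / (4 * β) - N * r + β * r ^ 2 = (N - 2 * β * r) ^ 2 / (4 * β) := by
      field_simp
      ring
    have h4 : 0 ≤ (N - 2 * β * r) ^ 2 / (4 * β) := by positivity
    linarith
  calc chartGaussian β u ≤ 1 * Real.exp (-β * r ^ 2) := by
        unfold chartGaussian
        gcongr
    _ ≤ Real.exp (N ^ 2 / (4 * β) + Real.log (1 + ‖u‖ ^ 2) * (-N / 2)) := by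
        rw [one_mul, Real.exp_le_exp]
        nlinarith
    _ = _ := by rw [Real.exp_add, Real.rpow_def_of_pos hs]

theorem integral_pos_of_continuous_of_nonneg {d : ℕ} {f : EuclideanSpace ℝ (Fin d) → ℝ}
    (hc : Continuous f) (hi : Integrable f) (h0 : ∀ u, 0 ≤ f u) {u₀ : EuclideanSpace ℝ (Fin d)}
    (hu : f u₀ ≠ 0) : 0 < ∫ u, f u :=
  (integral_pos_iff_support_of_nonneg h0 hi).2
    (hc.isOpen_support.measure_pos volume ⟨u₀, hu⟩)

theorem gaussianMass_pos (d : ℕ) {β : ℝ} (hβ : 0 < β) : 0 < gaussianMass (hypOrigin d) β := by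
  rw [gaussianMass_hypOrigin]
  exact integral_pos_of_continuous_of_nonneg (continuous_chartGaussian β)
    (integrable_chartGaussian hβ) (fun u => (chartGaussian_pos β u).le)
    (chartGaussian_pos β 0).ne'

theorem hdist_zero_hypOrigin (d : ℕ) : hdist (graphChart 0) (hypOrigin d) = 0 :=
  (hdist_eq_zero_iff _ _).2 rfl

theorem exists_hdist_pos {d : ℕ} (hd : 1 ≤ d) : ∃ u : EuclideanSpace ℝ (Fin d),
    0 < hdist (graphChart u) (hypOrigin d) := by
  have : Nonempty (Fin d) := ⟨⟨0, hd⟩⟩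
  obtain ⟨u, hu⟩ := exists_ne (0 : EuclideanSpace ℝ (Fin d))
  refine ⟨u, (hdist_nonneg _ _).lt_of_ne fun h => hu ?_⟩
  have h1 := (hdist_eq_zero_iff _ _).1 h.symm
  rw [← graphCoord_graphChart u, h1, hypOrigin, graphCoord_graphChart]

/-- Strict log-convexity, at midpoints, of the normalising constant. -/
theorem gaussianMass_midpoint_sq_lt {d : ℕ} (hd : 1 ≤ d) {a b : ℝ} (ha : 0 < a) (hb : 0 < b)
    (hab : a ≠ b) : gaussianMass (hypOrigin d) ((a + b) / 2) ^ 2 <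
      gaussianMass (hypOrigin d) a * gaussianMass (hypOrigin d) b := by
  have hm : 0 < (a + b) / 2 := by positivity
  -- Cauchy–Schwarz through a quadratic in `t`: it is the integral of the density times `(exp (-a r²
  -- / 2) - t exp (-b r² / 2)) ^ 2`.
  have key : ∀ t : ℝ, 0 < gaussianMass (hypOrigin d) a
      - 2 * t * gaussianMass (hypOrigin d) ((a + b) / 2)
      + t ^ 2 * gaussianMass (hypOrigin d) b := by
    intro t
    have ia := integrable_chartGaussian (d := d) ha
    have ib := (integrable_chartGaussian (d := d) hb).const_mul (t ^ 2)
    have im := (integrable_chartGaussian (d := d) hm).const_mul (2 * t)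
    have hform : ∀ u : EuclideanSpace ℝ (Fin d),
        chartGaussian a u - 2 * t * chartGaussian ((a + b) / 2) u + t ^ 2 * chartGaussian b u =
        (Real.sqrt (1 + ‖u‖ ^ 2))⁻¹ *
          (Real.exp (-(a / 2) * hdist (graphChart u) (hypOrigin d) ^ 2) -
            t * Real.exp (-(b / 2) * hdist (graphChart u) (hypOrigin d) ^ 2)) ^ 2 := by
      intro u
      have ea : -a * hdist (graphChart u) (hypOrigin d) ^ 2 =
        -(a / 2) * hdist (graphChart u) (hypOrigin d) ^ 2 +
        -(a / 2) * hdist (graphChart u) (hypOrigin d) ^ 2 := by ring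
      have eb : -b * hdist (graphChart u) (hypOrigin d) ^ 2 =
        -(b / 2) * hdist (graphChart u) (hypOrigin d) ^ 2 +
        -(b / 2) * hdist (graphChart u) (hypOrigin d) ^ 2 := by ring
      have em : -((a + b) / 2) * hdist (graphChart u) (hypOrigin d) ^ 2 =
        -(a / 2) * hdist (graphChart u) (hypOrigin d) ^ 2 +
        -(b / 2) * hdist (graphChart u) (hypOrigin d) ^ 2 := by ring
      simp only [chartGaussian, ea, eb, em, Real.exp_add]
      ring
    simp only [gaussianMass_hypOrigin]
    have iam : Integrable fun u : EuclideanSpace ℝ (Fin d) =>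
      chartGaussian a u - 2 * t * chartGaussian ((a + b) / 2) u := ia.sub im
    rw [← integral_const_mul, ← integral_const_mul, ← integral_sub ia im,
      ← integral_add iam ib]
    have hne : ∃ u : EuclideanSpace ℝ (Fin d), chartGaussian a u -
        2 * t * chartGaussian ((a + b) / 2) u + t ^ 2 * chartGaussian b u ≠ 0 := by
      by_contra! hcon
      have hz : ∀ u : EuclideanSpace ℝ (Fin d),
          Real.exp (-(a / 2) * hdist (graphChart u) (hypOrigin d) ^ 2) =
            t * Real.exp (-(b / 2) * hdist (graphChart u) (hypOrigin d) ^ 2) := by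
        intro u
        have h1 := hcon u
        rw [hform] at h1
        have h2 : (Real.sqrt (1 + ‖u‖ ^ 2))⁻¹ ≠ 0 := by positivity
        exact sub_eq_zero.1 (pow_eq_zero_iff two_ne_zero |>.1 ((mul_eq_zero.1 h1).resolve_left h2))
      -- At the origin both exponentials are `1`, which forces `t = 1`; a point with `r > 0` then
      -- forces `a = b`.
      have ht := hz 0
      rw [hdist_zero_hypOrigin] at ht
      simp only [ne_eq, OfNat.ofNat_ne_zero, not_false_eq_true, zero_pow, mul_zero, Real.exp_zero,
        mul_one] at ht
      obtain ⟨u, hu⟩ := exists_hdist_pos hd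
      have h3 := hz u
      rw [← ht, one_mul, Real.exp_eq_exp] at h3
      have := mul_right_cancel₀ (pow_pos hu 2).ne' h3
      exact hab (by linarith)
    obtain ⟨u₀, hu₀⟩ := hne
    refine integral_pos_of_continuous_of_nonneg (u₀ := u₀) ?_ (iam.add ib) ?_ hu₀
    · have h1 := continuous_chartGaussian (d := d) a
      have h2 := continuous_chartGaussian (d := d) b
      have h3 := continuous_chartGaussian (d := d) ((a + b) / 2)
      fun_prop
    · intro u
      exact (hform u).symm ▸ (by positivity)
  have hZb := gaussianMass_pos d hb
  -- This `t` is the vertex of the quadratic.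
  have h := key (gaussianMass (hypOrigin d) ((a + b) / 2) / gaussianMass (hypOrigin d) b)
  have h2 := mul_pos h hZb
  field_simp at h2
  linarith

theorem continuousOn_gaussianMass (d : ℕ) :
    ContinuousOn (fun β => gaussianMass (hypOrigin d) β) (Set.Ioi 0) := by
  intro β₀ hβ₀
  have hβ₀ : 0 < β₀ := hβ₀
  refine ContinuousAt.continuousWithinAt ?_
  simp only [gaussianMass_hypOrigin]
  refine continuousAt_of_dominated
    (Filter.Eventually.of_forall fun β => (continuous_chartGaussian β).aestronglyMeasurable)
    ?_ (integrable_chartGaussian (half_pos hβ₀)) (Filter.Eventually.of_forall fun u => ?_)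
  · filter_upwards [Ioi_mem_nhds (half_lt_self hβ₀)] with β hβ
    refine Filter.Eventually.of_forall fun u => ?_
    rw [Real.norm_of_nonneg (chartGaussian_pos β u).le]
    exact chartGaussian_anti (le_of_lt hβ) u
  · unfold chartGaussian
    fun_prop

theorem gaussianMass_strictAnti {d : ℕ} (hd : 1 ≤ d) {a b : ℝ} (ha : 0 < a) (hab : a < b) :
    gaussianMass (hypOrigin d) b < gaussianMass (hypOrigin d) a := by
  have ia := integrable_chartGaussian (d := d) ha
  have ib := integrable_chartGaussian (d := d) (ha.trans hab)
  obtain ⟨u, hu⟩ := exists_hdist_pos hd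
  rw [gaussianMass_hypOrigin, gaussianMass_hypOrigin, ← sub_pos, ← integral_sub ia ib]
  refine integral_pos_of_continuous_of_nonneg (u₀ := u)
    ((continuous_chartGaussian a).sub (continuous_chartGaussian b)) (ia.sub ib)
    (fun u => sub_nonneg.2 (chartGaussian_anti hab.le u)) (sub_pos.2 ?_).ne'
  unfold chartGaussian
  gcongr

/-- Dominated convergence, with the integrand at `β = 1` as bound; the pointwise limit is `0` off
the origin, which is a null set as `d ≥ 1`. -/
theorem tendsto_gaussianMass_atTop {d : ℕ} (hd : 1 ≤ d) :
    Filter.Tendsto (fun β => gaussianMass (hypOrigin d) β) Filter.atTop (nhds 0) := by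
  have : Nonempty (Fin d) := ⟨⟨0, hd⟩⟩
  simp only [gaussianMass_hypOrigin]
  rw [← integral_zero (EuclideanSpace ℝ (Fin d)) ℝ]
  refine tendsto_integral_filter_of_dominated_convergence (chartGaussian 1)
    (Filter.Eventually.of_forall fun β => (continuous_chartGaussian β).aestronglyMeasurable)
    ?_ (integrable_chartGaussian one_pos) ?_
  · filter_upwards [Filter.eventually_ge_atTop 1] with β hβ
    refine Filter.Eventually.of_forall fun u => ?_
    rw [Real.norm_of_nonneg (chartGaussian_pos β u).le]
    exact chartGaussian_anti hβ u
  · have hae : ∀ᵐ u : EuclideanSpace ℝ (Fin d), u ≠ 0 := by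
      simp [ae_iff]
    filter_upwards [hae] with u hu
    have hr : 0 < hdist (graphChart u) (hypOrigin d) := by
      refine (hdist_nonneg _ _).lt_of_ne fun h => hu ?_
      have h1 := (hdist_eq_zero_iff _ _).1 h.symm
      rw [← graphCoord_graphChart u, h1, hypOrigin, graphCoord_graphChart]
    unfold chartGaussian
    rw [← mul_zero (Real.sqrt (1 + ‖u‖ ^ 2))⁻¹]
    refine (Real.tendsto_exp_atBot.comp ?_).const_mul _
    exact Filter.tendsto_neg_atTop_atBot.atBot_mul_const (pow_pos hr 2)

/-- The volume of `ℍ^d` is infinite. -/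
theorem not_integrable_inv_sqrt_one_add_norm_sq {d : ℕ} (hd : 1 ≤ d) :
    ¬ Integrable fun u : EuclideanSpace ℝ (Fin d) => (Real.sqrt (1 + ‖u‖ ^ 2))⁻¹ := by
  intro hi
  -- If the density `ρ` were integrable, `2 ^ d ρ(2u)` would have the same integral as `ρ(u)`; but
  -- it is pointwise strictly larger, since `2 ^ d ≥ 2`.
  have hi2 := (hi.comp_smul (R := (2 : ℝ)) two_ne_zero).const_mul ((2 : ℝ) ^ d)
  have hscale := Measure.integral_comp_smul (volume : Measure (EuclideanSpace ℝ (Fin d)))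
    (fun u => (Real.sqrt (1 + ‖u‖ ^ 2))⁻¹) 2
  rw [finrank_euclideanSpace_fin, abs_of_pos (by positivity), smul_eq_mul] at hscale
  have hlt : ∀ u : EuclideanSpace ℝ (Fin d), 0 < (2 : ℝ) ^ d *
      (Real.sqrt (1 + ‖(2 : ℝ) • u‖ ^ 2))⁻¹ - (Real.sqrt (1 + ‖u‖ ^ 2))⁻¹ := by
    intro u
    have h1 : Real.sqrt (1 + ‖(2 : ℝ) • u‖ ^ 2) < 2 * Real.sqrt (1 + ‖u‖ ^ 2) := by
      rw [Real.sqrt_lt' (by positivity), mul_pow, Real.sq_sqrt (by positivity), norm_smul]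
      norm_num
      nlinarith
    have h2 : (2 : ℝ) ≤ 2 ^ d := by simpa using pow_le_pow_right₀ (one_le_two (α := ℝ)) hd
    have hs : 0 < Real.sqrt (1 + ‖(2 : ℝ) • u‖ ^ 2) := by positivity
    have hs2 : 0 < Real.sqrt (1 + ‖u‖ ^ 2) := by positivity
    rw [sub_pos, ← div_eq_mul_inv, inv_lt_comm₀ hs2 (by positivity), inv_div,
      div_lt_iff₀ (by positivity)]
    nlinarith
  have hc := continuous_inv_sqrt_one_add_norm_sq d
  have hpos := integral_pos_of_continuous_of_nonneg (u₀ := (0 : EuclideanSpace ℝ (Fin d)))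
    (((hc.comp (continuous_const_smul (2 : ℝ))).const_mul ((2 : ℝ) ^ d)).sub hc) (hi2.sub hi)
    (fun u => (hlt u).le) (hlt 0).ne'
  have heq := integral_sub hi2 hi
  rw [integral_const_mul, hscale, mul_inv_cancel_left₀ (by positivity), sub_self] at heq
  exact hpos.ne' heq

/-- Were the mass bounded along scales tending to `0`, monotonicity would bound it at all `1 / (n +
1)`, and Fatou's lemma would make the volume finite. -/
theorem exists_lt_gaussianMass {d : ℕ} (hd : 1 ≤ d) (C : ℝ) :
    ∃ δ, 0 < δ ∧ ∀ β, 0 < β → β ≤ δ → C < gaussianMass (hypOrigin d) β := by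
  by_contra! hcon
  have hle : ∀ n : ℕ, gaussianMass (hypOrigin d) (1 / ((n : ℝ) + 1)) ≤ C := by
    intro n
    obtain ⟨β, hβ, hβn, hC⟩ := hcon (1 / ((n : ℝ) + 1)) (by positivity)
    rcases hβn.eq_or_lt with h | h
    · rwa [← h]
    · exact (gaussianMass_strictAnti hd hβ h).le.trans hC
  refine not_integrable_inv_sqrt_one_add_norm_sq hd ⟨
    (continuous_inv_sqrt_one_add_norm_sq d).aestronglyMeasurable, ?_⟩
  have hlim : ∀ u : EuclideanSpace ℝ (Fin d), Filter.Tendsto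
      (fun n : ℕ => ‖chartGaussian (1 / ((n : ℝ) + 1)) u‖ₑ) Filter.atTop
      (nhds ‖(Real.sqrt (1 + ‖u‖ ^ 2))⁻¹‖ₑ) := by
    intro u
    have hc : Continuous fun β : ℝ => chartGaussian β u := by
      unfold chartGaussian
      fun_prop
    have h0 : chartGaussian 0 u = (Real.sqrt (1 + ‖u‖ ^ 2))⁻¹ := by simp [chartGaussian]
    rw [← h0]
    exact ((hc.tendsto 0).comp tendsto_one_div_add_atTop_nhds_zero_nat).enorm
  have hfatou : ∫⁻ u : EuclideanSpace ℝ (Fin d), ‖(Real.sqrt (1 + ‖u‖ ^ 2))⁻¹‖ₑ ≤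
      Filter.liminf (fun n : ℕ => ∫⁻ u : EuclideanSpace ℝ (Fin d),
        ‖chartGaussian (1 / ((n : ℝ) + 1)) u‖ₑ) Filter.atTop := by
    refine le_trans (le_of_eq ?_) (lintegral_liminf_le fun n =>
      (continuous_chartGaussian _).enorm.measurable)
    exact lintegral_congr fun u => (hlim u).liminf_eq.symm
  refine (hfatou.trans (Filter.liminf_le_of_le (a := ENNReal.ofReal C) (by isBoundedDefault)
    fun b hb => ?_)).trans_lt ENNReal.ofReal_lt_top
  obtain ⟨n, hn⟩ := hb.exists
  refine hn.trans ?_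
  rw [← ofReal_integral_norm_eq_lintegral_enorm (integrable_chartGaussian (by positivity))]
  refine ENNReal.ofReal_le_ofReal ?_
  simp only [Real.norm_of_nonneg (chartGaussian_pos _ _).le]
  rw [← gaussianMass_hypOrigin]
  exact hle n

/-- Only a small ball around the origin, where `r² < ε`, is kept from the integral. In logarithmic
form `A_d(β) ≥ log c - β ε`, so any positive linear term eventually wins over `A_d`. -/
theorem exists_mul_exp_le_gaussianMass (d : ℕ) {ε : ℝ} (hε : 0 < ε) :
    ∃ c, 0 < c ∧ ∀ β, 0 < β → c * Real.exp (-β * ε) ≤ gaussianMass (hypOrigin d) β := by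
  set A : Set (EuclideanSpace ℝ (Fin d)) :=
    {u | hdist (graphChart u) (hypOrigin d) ^ 2 < ε} with hA
  have hAo : IsOpen A := isOpen_lt ((continuous_hdist_graphChart d).pow 2) continuous_const
  have h0 : (0 : EuclideanSpace ℝ (Fin d)) ∈ A := by
    simp only [hA, Set.mem_ofPred_eq, hdist_zero_hypOrigin]
    simpa using hε
  obtain ⟨ρ, hρ, hball⟩ := Metric.isOpen_iff.1 hAo 0 h0
  set B := Metric.ball (0 : EuclideanSpace ℝ (Fin d)) ρ with hB
  refine ⟨volume.real B * (Real.sqrt (1 + ρ ^ 2))⁻¹, ?_, fun β hβ => ?_⟩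
  · have : 0 < volume.real B :=
      ENNReal.toReal_pos (Metric.measure_ball_pos volume _ hρ).ne' measure_ball_lt_top.ne
    positivity
  rw [gaussianMass_hypOrigin]
  have hi := integrable_chartGaussian (d := d) hβ
  calc volume.real B * (Real.sqrt (1 + ρ ^ 2))⁻¹ * Real.exp (-β * ε)
      = ∫ _ in B, (Real.sqrt (1 + ρ ^ 2))⁻¹ * Real.exp (-β * ε) := by
        rw [setIntegral_const, smul_eq_mul, mul_assoc]
    _ ≤ ∫ u in B, chartGaussian β u := by
        refine setIntegral_mono_on (integrableOn_const measure_ball_lt_top.ne) hi.integrableOn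
          measurableSet_ball fun u hu => ?_
        have h1 : hdist (graphChart u) (hypOrigin d) ^ 2 < ε := hball hu
        have h2 : ‖u‖ ≤ ρ := by simpa [hB] using (mem_ball_zero_iff.1 hu).le
        unfold chartGaussian
        have h3 : -β * ε ≤ -β * hdist (graphChart u) (hypOrigin d) ^ 2 := by nlinarith
        gcongr
    _ ≤ _ := setIntegral_le_integral hi
        (Filter.Eventually.of_forall fun u => (chartGaussian_pos β u).le)

/-! ### The weighted Fréchet mean -/

/-- Coercivity: the distance to the origin grows at least like `log ‖u‖`, and moving the base point
to `p` costs a bounded amount. -/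
theorem tendsto_hdist_cocompact {d : ℕ} (p : Hyperboloid d) :
    Filter.Tendsto (fun u : EuclideanSpace ℝ (Fin d) => hdist p (graphChart u))
      (Filter.cocompact _) Filter.atTop := by
  have h0 : Filter.Tendsto (fun u : EuclideanSpace ℝ (Fin d) => Real.sqrt (1 + ‖u‖ ^ 2))
      (Filter.cocompact _) Filter.atTop :=
    Filter.tendsto_atTop_mono (fun u => Real.le_sqrt_of_sq_le (by linarith))
      (tendsto_norm_cocompact_atTop (E := EuclideanSpace ℝ (Fin d)))
  refine Filter.tendsto_atTop_mono (fun u => ?_) (Filter.tendsto_atTop_add_const_right _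
    (-hdist (hypOrigin d) p) (Real.tendsto_log_atTop.comp h0))
  have h1 := log_sqrt_le_hdist u
  have h2 := (abs_le.1 (abs_hdist_sub_hdist_le (graphChart u) (hypOrigin d) p)).2
  rw [hdist_comm p]
  simp only [Function.comp_apply]
  linarith

section Frechet

variable {d n : ℕ} {x : Fin n → Hyperboloid d} {w : Fin n → ℝ}

theorem frechetFunctional_nonneg (hw : ∀ i, 0 ≤ w i) (μ : Hyperboloid d) :
    0 ≤ frechetFunctional x w μ :=
  Finset.sum_nonneg fun i _ => mul_nonneg (hw i) (sq_nonneg _)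

theorem frechetFunctional_eq_zero_iff (hw : ∀ i, 0 ≤ w i) (μ : Hyperboloid d) :
    frechetFunctional x w μ = 0 ↔ ∀ i, 0 < w i → x i = μ := by
  rw [frechetFunctional, Finset.sum_eq_zero_iff_of_nonneg fun i _ =>
    mul_nonneg (hw i) (sq_nonneg _)]
  refine forall_congr' fun i => ?_
  simp only [Finset.mem_univ, true_imp_iff, mul_eq_zero, pow_eq_zero_iff two_ne_zero,
    hdist_eq_zero_iff]
  refine ⟨fun h hi => h.resolve_left hi.ne', fun h => ?_⟩
  rcases (hw i).eq_or_lt with h0 | h0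
  · exact Or.inl h0.symm
  · exact Or.inr (h h0)

theorem exists_frechetFunctional_le (hw : ∀ i, 0 ≤ w i) (hw0 : ∃ i, w i ≠ 0) :
    ∃ μ, ∀ ν, frechetFunctional x w μ ≤ frechetFunctional x w ν := by
  obtain ⟨i, hi⟩ := hw0
  have hi : 0 < w i := (hw i).lt_of_ne' hi
  have hcont : Continuous fun u => frechetFunctional x w (graphChart u) := by
    refine continuous_finsetSum _ fun j _ => ?_
    simp only [hdist_comm (x j)]
    exact (((continuous_hdist (x j)).comp continuous_graphChart).pow 2).const_mul _
  have hlim : Filter.Tendsto (fun u => frechetFunctional x w (graphChart u))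
      (Filter.cocompact _) Filter.atTop := by
    refine Filter.tendsto_atTop_mono (fun u => ?_) (((Filter.tendsto_pow_atTop two_ne_zero).comp
      (tendsto_hdist_cocompact (x i))).const_mul_atTop hi)
    exact Finset.single_le_sum (f := fun j => w j * hdist (x j) (graphChart u) ^ 2)
      (fun j _ => mul_nonneg (hw j) (sq_nonneg _)) (Finset.mem_univ i)
  obtain ⟨u, hu⟩ := hcont.exists_forall_le hlim
  refine ⟨graphChart u, fun ν => ?_⟩
  rw [← graphChart_graphCoord ν]
  exact hu _

theorem frechetFunctional_hypMidpoint_lt (hw : ∀ i, 0 ≤ w i) (hw0 : ∃ i, w i ≠ 0)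
    {p q : Hyperboloid d} (hpq : p ≠ q) : frechetFunctional x w (hypMidpoint p q) <
      (frechetFunctional x w p + frechetFunctional x w q) / 2 := by
  obtain ⟨i, hi⟩ := hw0
  have hi : 0 < w i := (hw i).lt_of_ne' hi
  simp only [frechetFunctional]
  rw [← Finset.sum_add_distrib, Finset.sum_div]
  refine Finset.sum_lt_sum (fun j _ => ?_) ⟨i, Finset.mem_univ i, ?_⟩
  · have := mul_le_mul_of_nonneg_left (hdist_hypMidpoint_sq_lt (x j) hpq).le (hw j)
    linarith
  · have := mul_lt_mul_of_pos_left (hdist_hypMidpoint_sq_lt (x i) hpq) hi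
    linarith

/-- Existence and uniqueness of the weighted Fréchet mean. -/
theorem exists_unique_frechetMean (x : Fin n → Hyperboloid d) (hw : ∀ i, 0 ≤ w i)
    (hw0 : ∃ i, w i ≠ 0) :
    ∃ μ, ∀ ν, frechetFunctional x w μ ≤ frechetFunctional x w ν ∧
      (frechetFunctional x w ν ≤ frechetFunctional x w μ → ν = μ) := by
  obtain ⟨μ, hμ⟩ := exists_frechetFunctional_le (x := x) hw hw0
  refine ⟨μ, fun ν => ⟨hμ ν, fun h => ?_⟩⟩
  by_contra hne
  have := frechetFunctional_hypMidpoint_lt (x := x) hw hw0 hne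
  linarith [hμ (hypMidpoint ν μ)]

/-! ### The likelihood and the scale objective -/

/-- Homogeneity is used here: the normaliser at `μ` is replaced by the one at the origin, which
separates location from scale. -/
theorem weightedLogLik_eq (x : Fin n → Hyperboloid d) (w : Fin n → ℝ) (μ : Hyperboloid d)
    {β : ℝ} (hβ : 0 < β) : weightedLogLik x w μ β = -scaleObjective x w μ β := by
  have hZ := gaussianMass_pos d hβ
  simp only [weightedLogLik, scaleObjective, gaussianDensity, gaussianMass_eq_hypOrigin μ,
    logNormalizer, frechetFunctional]
  rw [Finset.mul_sum, Finset.sum_mul, ← Finset.sum_add_distrib, ← Finset.sum_neg_distrib]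
  refine Finset.sum_congr rfl fun i _ => ?_
  rw [Real.log_mul (inv_pos.2 hZ).ne' (Real.exp_pos _).ne', Real.log_inv, Real.log_exp]
  ring

theorem continuousOn_scaleObjective (x : Fin n → Hyperboloid d) (w : Fin n → ℝ)
    (μ : Hyperboloid d) : ContinuousOn (scaleObjective x w μ) (Set.Ioi 0) :=
  (continuousOn_id.mul continuousOn_const).add (continuousOn_const.mul
    ((continuousOn_gaussianMass d).log fun _ hβ => (gaussianMass_pos d hβ).ne'))

theorem scaleObjective_midpoint_lt (hd : 1 ≤ d) (hW : 0 < ∑ i, w i) (μ : Hyperboloid d)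
    {a b : ℝ} (ha : 0 < a) (hb : 0 < b) (hab : a ≠ b) : scaleObjective x w μ ((a + b) / 2) <
      (scaleObjective x w μ a + scaleObjective x w μ b) / 2 := by
  have hm : 0 < (a + b) / 2 := by positivity
  have hlog := Real.log_lt_log (pow_pos (gaussianMass_pos d hm) 2)
    (gaussianMass_midpoint_sq_lt hd ha hb hab)
  rw [Real.log_mul (gaussianMass_pos d ha).ne' (gaussianMass_pos d hb).ne', Real.log_pow] at hlog
  have := mul_lt_mul_of_pos_left hlog hW
  simp only [scaleObjective, logNormalizer]
  push_cast at this
  linarith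

/-- A minimiser of the scale objective over a convex set of scales is unique, and together with
the Fréchet mean it is the unique joint maximiser of the likelihood. -/
theorem unique_scale_of_isMinOn (hd : 1 ≤ d) (hW : 0 < ∑ i, w i) {μhat : Hyperboloid d}
    (hμ : ∀ ν, frechetFunctional x w μhat ≤ frechetFunctional x w ν ∧
      (frechetFunctional x w ν ≤ frechetFunctional x w μhat → ν = μhat))
    {B : Set ℝ} (hB : Convex ℝ B) (hB0 : B ⊆ Set.Ioi 0) {βhat : ℝ} (hβB : βhat ∈ B)
    (hmin : IsMinOn (scaleObjective x w μhat) B βhat) :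
    (∀ β ∈ B, (IsMinOn (scaleObjective x w μhat) B β ↔ β = βhat)) ∧
    (∀ (μ : Hyperboloid d), ∀ β ∈ B,
      (IsMaxOn (fun q : Hyperboloid d × ℝ => weightedLogLik x w q.1 q.2)
        (Set.univ ×ˢ B) (μ, β) ↔ μ = μhat ∧ β = βhat)) := by
  have huniq : ∀ β ∈ B, (IsMinOn (scaleObjective x w μhat) B β ↔ β = βhat) := by
    refine fun β hβ => ⟨fun h => ?_, fun h => h ▸ hmin⟩
    by_contra hne
    have hlt := scaleObjective_midpoint_lt (x := x) hd hW μhat (hB0 hβ) (hB0 hβB) hne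
    have hmem : (β + βhat) / 2 ∈ B := by
      have := hB hβ hβB (show (0 : ℝ) ≤ 1 / 2 by norm_num) (show (0 : ℝ) ≤ 1 / 2 by norm_num)
        (by norm_num)
      simp only [smul_eq_mul] at this
      convert this using 1
      ring
    have h1 := isMinOn_iff.1 h _ hmem
    have h2 := isMinOn_iff.1 hmin _ hmem
    linarith
  refine ⟨huniq, fun μ β hβ => ⟨fun h => ?_, ?_⟩⟩
  · have hβ0 : 0 < β := hB0 hβ
    -- Comparison with `(μhat, β)` at the same scale cancels the normaliser and leaves only the
    -- Fréchet functional.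
    have hμeq : μ = μhat := by
      have h1 := isMaxOn_iff.1 h (μhat, β) ⟨Set.mem_univ _, hβ⟩
      simp only [weightedLogLik_eq x w _ hβ0, scaleObjective] at h1
      exact (hμ μ).2 (le_of_mul_le_mul_left (by linarith) hβ0)
    subst hμeq
    refine ⟨rfl, (huniq β hβ).1 (isMinOn_iff.2 fun b hb => ?_)⟩
    have h1 := isMaxOn_iff.1 h (μ, b) ⟨Set.mem_univ _, hb⟩
    simp only [weightedLogLik_eq x w _ hβ0, weightedLogLik_eq x w _ (hB0 hb)] at h1
    linarith
  · rintro ⟨rfl, rfl⟩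
    refine isMaxOn_iff.2 fun ⟨ν, b⟩ ⟨_, hb⟩ => ?_
    have hb0 : 0 < b := hB0 hb
    simp only [weightedLogLik_eq x w _ (hB0 hβB), weightedLogLik_eq x w _ hb0]
    have h1 := isMinOn_iff.1 hmin b hb
    have h2 : scaleObjective x w μ b ≤ scaleObjective x w ν b :=
      add_le_add_left (mul_le_mul_of_nonneg_left (hμ ν).1 hb0.le) _
    linarith

theorem exists_isMinOn_scaleObjective (hd : 1 ≤ d) (hW : 0 < ∑ i, w i) {μ : Hyperboloid d}
    (hS : 0 < frechetFunctional x w μ) :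
    ∃ β, 0 < β ∧ IsMinOn (scaleObjective x w μ) (Set.Ioi 0) β := by
  set S := frechetFunctional x w μ with hSdef
  set W := ∑ i, w i with hWdef
  set M := scaleObjective x w μ 1 with hM
  -- Below `δ` the term `W A_d` alone exceeds `M`, the value at `β = 1`. The choice `ε = S / (2W)`
  -- in the next line lets the decay of `W A_d` use up only half of `β S`.
  obtain ⟨δ, hδ, hsmall⟩ := exists_lt_gaussianMass hd (Real.exp (M / W))
  obtain ⟨c, hc, hlarge⟩ := exists_mul_exp_le_gaussianMass d (ε := S / (2 * W)) (by positivity)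
  have h1 : ∀ β, 0 < β → β ≤ δ → M < scaleObjective x w μ β := by
    intro β hβ hβδ
    have hl := (Real.lt_log_iff_exp_lt (gaussianMass_pos d hβ)).2 (hsmall β hβ hβδ)
    have h2 := (div_lt_iff₀' hW).1 hl
    have h3 : 0 < β * S := by positivity
    simp only [scaleObjective, logNormalizer, ← hSdef, ← hWdef]
    linarith
  have h2 : ∀ β, 0 < β → β * (S / 2) + W * Real.log c ≤ scaleObjective x w μ β := by
    intro β hβ
    have hl := Real.log_le_log (by positivity) (hlarge β hβ)
    rw [Real.log_mul hc.ne' (Real.exp_pos _).ne', Real.log_exp] at hl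
    have h3 := mul_le_mul_of_nonneg_left hl hW.le
    have h4 : W * (-β * (S / (2 * W))) = -(β * (S / 2)) := by field_simp
    simp only [scaleObjective, logNormalizer, ← hSdef, ← hWdef]
    linarith
  -- Beyond `R` the linear lower bound exceeds `M`. Both endpoints are arranged so that `1` lies in
  -- `[r, R]`, hence the minimum over this interval is at most `M` and is global.
  set R := max 1 ((M - W * Real.log c) / (S / 2)) with hR
  set r := min δ 1 with hr
  have hr0 : 0 < r := lt_min hδ one_pos
  have hsub : Set.Icc r R ⊆ Set.Ioi 0 := fun β hβ => hr0.trans_le hβ.1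
  have h1mem : (1 : ℝ) ∈ Set.Icc r R := ⟨min_le_right _ _, le_max_left _ _⟩
  obtain ⟨β, hβ, hmin⟩ := isCompact_Icc.exists_isMinOn ⟨1, h1mem⟩
    ((continuousOn_scaleObjective x w μ).mono hsub)
  refine ⟨β, hsub hβ, isMinOn_iff.2 fun b hb => ?_⟩
  have hb : 0 < b := hb
  have hβM : scaleObjective x w μ β ≤ M := isMinOn_iff.1 hmin 1 h1mem
  by_cases hbr : b < r
  · exact hβM.trans (h1 b hb (hbr.le.trans (min_le_left _ _))).le
  by_cases hbR : R < b
  · have h3 := (div_lt_iff₀ (by positivity)).1 ((le_max_right _ _).trans_lt hbR)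
    linarith [h2 b hb]
  · exact isMinOn_iff.1 hmin b ⟨not_lt.1 hbr, not_lt.1 hbR⟩

/-- With `S_w = 0` the objective is `W log Z_d(β)`, and `Z_d(β)` tends to `0`. -/
theorem not_bddBelow_scaleObjective (hd : 1 ≤ d) (hW : 0 < ∑ i, w i) {μ : Hyperboloid d}
    (hS : frechetFunctional x w μ = 0) (C : ℝ) : ∃ β, 0 < β ∧ scaleObjective x w μ β < C := by
  obtain ⟨β, hlt, hβ⟩ := (((tendsto_gaussianMass_atTop hd).eventually
    (gt_mem_nhds (Real.exp_pos (C / ∑ i, w i)))).and (Filter.eventually_gt_atTop 0)).exists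
  refine ⟨β, hβ, ?_⟩
  have h1 := (lt_div_iff₀' hW).1
    ((Real.log_lt_iff_lt_exp (gaussianMass_pos d hβ)).2 hlt)
  simpa only [scaleObjective, logNormalizer, hS, mul_zero, zero_add] using h1

theorem positiveSampleSingleton_iff (hw : ∀ i, 0 ≤ w i) (hw0 : ∃ i, w i ≠ 0)
    {μhat : Hyperboloid d}
    (hμ : ∀ ν, frechetFunctional x w μhat ≤ frechetFunctional x w ν) :
    PositiveSampleSingleton x w ↔ frechetFunctional x w μhat = 0 := by
  constructor
  · rintro ⟨p, hp⟩
    have h0 : frechetFunctional x w p = 0 :=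
      (frechetFunctional_eq_zero_iff hw p).2 fun i hi => by
        have : x i ∈ x '' {i | 0 < w i} := ⟨i, hi, rfl⟩
        rwa [hp] at this
    exact le_antisymm (h0 ▸ hμ p) (frechetFunctional_nonneg hw _)
  · intro h
    obtain ⟨i, hi⟩ := hw0
    have hi : 0 < w i := (hw i).lt_of_ne' hi
    have h1 := (frechetFunctional_eq_zero_iff hw _).1 h
    refine ⟨μhat, Set.Subset.antisymm ?_ ?_⟩
    · rintro _ ⟨j, hj, rfl⟩
      exact h1 j hj
    · rintro _ rfl
      exact ⟨i, hi, h1 i hi⟩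

end Frechet

theorem mainTheorem1 {d n : ℕ} (hd : 1 ≤ d) (x : Fin n → Hyperboloid d) (w : Fin n → ℝ)
    (hw : ∀ i, 0 ≤ w i) (hw0 : ∃ i, w i ≠ 0) :
    ∃ μhat : Hyperboloid d,
      -- (i) `μhat` is the unique weighted Fréchet mean, and the unique location MLE for every scale
      (∀ μ, IsMinOn (frechetFunctional x w) Set.univ μ ↔ μ = μhat) ∧
      (∀ β : ℝ, 0 < β → ∀ μ,
        IsMaxOn (fun m => weightedLogLik x w m β) Set.univ μ ↔ μ = μhat) ∧
      -- the two descriptions of the nondegenerate case agree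
      (¬ PositiveSampleSingleton x w ↔ 0 < frechetFunctional x w μhat) ∧
      -- (ii) nondegenerate case: unique unconstrained scale MLE, and unique joint MLE
      (¬ PositiveSampleSingleton x w →
        ∃ βhat : ℝ, 0 < βhat ∧
          (∀ β : ℝ, 0 < β →
            (IsMinOn (scaleObjective x w μhat) (Set.Ioi 0) β ↔ β = βhat)) ∧
          (∀ (μ : Hyperboloid d) (β : ℝ), 0 < β →
            (IsMaxOn (fun q : Hyperboloid d × ℝ => weightedLogLik x w q.1 q.2)
              (Set.univ ×ˢ Set.Ioi 0) (μ, β) ↔ μ = μhat ∧ β = βhat))) ∧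
      -- (iii) degenerate case: the likelihood is unbounded above in `β`; no scale MLE exists
      (PositiveSampleSingleton x w →
        frechetFunctional x w μhat = 0 ∧
        ¬ BddAbove (weightedLogLik x w μhat '' Set.Ioi 0) ∧
        (¬ ∃ β : ℝ, 0 < β ∧ IsMinOn (scaleObjective x w μhat) (Set.Ioi 0) β) ∧
        (¬ ∃ (μ : Hyperboloid d) (β : ℝ), 0 < β ∧
          IsMaxOn (fun q : Hyperboloid d × ℝ => weightedLogLik x w q.1 q.2)
            (Set.univ ×ˢ Set.Ioi 0) (μ, β))) ∧
      -- (iv) unique constrained scale MLE, and unique joint MLE, on every compact interval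
      (∀ a b : ℝ, 0 < a → a ≤ b →
        ∃ βhat ∈ Set.Icc a b,
          (∀ β ∈ Set.Icc a b,
            (IsMinOn (scaleObjective x w μhat) (Set.Icc a b) β ↔ β = βhat)) ∧
          (∀ (μ : Hyperboloid d), ∀ β ∈ Set.Icc a b,
            (IsMaxOn (fun q : Hyperboloid d × ℝ => weightedLogLik x w q.1 q.2)
              (Set.univ ×ˢ Set.Icc a b) (μ, β) ↔ μ = μhat ∧ β = βhat))) := by
  have hW : 0 < ∑ i, w i := by
    obtain ⟨i, hi⟩ := hw0
    exact Finset.sum_pos' (fun j _ => hw j) ⟨i, Finset.mem_univ i, (hw i).lt_of_ne' hi⟩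
  obtain ⟨μhat, hμ⟩ := exists_unique_frechetMean x hw hw0
  have hsing := positiveSampleSingleton_iff hw hw0 fun ν => (hμ ν).1
  have hpos : ¬ PositiveSampleSingleton x w ↔ 0 < frechetFunctional x w μhat := by
    rw [hsing]
    exact (frechetFunctional_nonneg hw μhat).lt_iff_ne'.symm
  refine ⟨μhat, fun μ => ?_, fun β hβ μ => ?_, hpos, fun hns => ?_, fun hs => ?_,
    fun a b ha hab => ?_⟩
  · refine ⟨fun h => (hμ μ).2 (isMinOn_iff.1 h μhat (Set.mem_univ _)), ?_⟩
    rintro rfl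
    exact isMinOn_iff.2 fun ν _ => (hμ ν).1
  · simp only [isMaxOn_iff, weightedLogLik_eq x w _ hβ, scaleObjective]
    refine ⟨fun h => (hμ μ).2 (le_of_mul_le_mul_left ?_ hβ), ?_⟩
    · linarith [h μhat (Set.mem_univ _)]
    · rintro rfl ν -
      linarith [mul_le_mul_of_nonneg_left (hμ ν).1 hβ.le]
  · obtain ⟨βhat, hβ, hmin⟩ := exists_isMinOn_scaleObjective hd hW (hpos.1 hns)
    exact ⟨βhat, hβ, unique_scale_of_isMinOn hd hW hμ (convex_Ioi 0) subset_rfl hβ hmin⟩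
  · have hS := hsing.1 hs
    refine ⟨hS, ?_, ?_, ?_⟩
    · rintro ⟨C, hC⟩
      obtain ⟨β, hβ, hlt⟩ := not_bddBelow_scaleObjective (x := x) hd hW hS (-C)
      have := hC ⟨β, hβ, rfl⟩
      rw [weightedLogLik_eq x w _ hβ] at this
      linarith
    · rintro ⟨β, _, hmin⟩
      obtain ⟨b, hb, hlt⟩ := not_bddBelow_scaleObjective (x := x) hd hW hS
        (scaleObjective x w μhat β)
      exact hlt.not_ge (isMinOn_iff.1 hmin b hb)
    -- A joint maximum at any `(μ, β)` would bound the likelihood along `μhat`, where it is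
    -- unbounded.
    · rintro ⟨μ, β, _, hmax⟩
      obtain ⟨b, hb, hlt⟩ := not_bddBelow_scaleObjective (x := x) hd hW hS
        (-weightedLogLik x w μ β)
      have := isMaxOn_iff.1 hmax (μhat, b) ⟨Set.mem_univ _, hb⟩
      simp only [weightedLogLik_eq x w μhat hb] at this
      linarith
  · have hsub : Set.Icc a b ⊆ Set.Ioi 0 := fun β hβ => ha.trans_le hβ.1
    obtain ⟨βhat, hβ, hmin⟩ := isCompact_Icc.exists_isMinOn (Set.nonempty_Icc.2 hab)
      ((continuousOn_scaleObjective x w μhat).mono hsub)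
    exact ⟨βhat, hβ, unique_scale_of_isMinOn hd hW hμ (convex_Icc a b) hsub hβ hmin⟩
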